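/- For a nonnegative integer $n$, let $a(n)$ denote the number of partitions of $n$ in which every part that occurs appears with odd multiplicity. Then, outside the arithmetic progression $n\equiv 7 \pmod 8$, $a(n)$ is odd with density zero; that is, $$\lim_{x\to\infty}\frac{\#\{n\le x:\ n\not\equiv 7 \!\!\pmod 8,\ a(n)\text{ is odd}\}}{x}=0 .$$ In particular, the set of all $n$ for which $a(n)$ is odd has upper density at most $1/8$, i.e. $$\limsup_{x\to\infty}\frac{\#\{n\le x:\ a(n)\text{ is odd}\}}{x}\le \frac18 ,$$ and hence, if the density $\lim_{x\to\infty}\#\{n\le x: a(n)\text{ is odd}\}/x$ exists, it is at most $1/8$. -/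

import Mathlib

/-- The number `a(n)` of partitions of `n` in which every part that occurs has odd multiplicity. -/
def oddMultPartitionCount (n : ℕ) : ℕ :=
  (Finset.univ.filter
    (fun p : n.Partition => ∀ i ∈ p.parts, Odd (p.parts.count i))).card

/-- The proportion `#{n ≤ x : n ∈ S} / x`, for a set `S` of nonnegative integers and real `x`. -/
noncomputable def countingRatio (S : Set ℕ) (x : ℝ) : ℝ :=
  ({n : ℕ | (n : ℝ) ≤ x ∧ n ∈ S}.ncard : ℝ) / x

/-- `S` has (natural) density `d`: the limit of `#{n ≤ x : n ∈ S} / x` as `x → ∞` exists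
and equals `d`. -/
def HasNaturalDensity (S : Set ℕ) (d : ℝ) : Prop :=
  Filter.Tendsto (countingRatio S) Filter.atTop (nhds d)

/-- The upper density `limsup_{x → ∞} #{n ≤ x : n ∈ S} / x`. The ratio lies between `0` and `2`
for all `x ≥ 1`, so that the real-valued `limsup` is the genuine one. -/
noncomputable def upperNaturalDensity (S : Set ℕ) : ℝ :=
  Filter.limsup (countingRatio S) Filter.atTop

/-!
Modulo 2 the generating function of `a(n) = oddMultPartitionCount n` is
`A = ∏ (1 - X ^ (3 * n)) / ∏ (1 - X ^ n) ^ 3`. Write `P` and `Q` for the Euler products in `X` and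
`X ^ 3`, so that `A * P ^ 3 = Q` (`oddMultSeries_mul_eulerSeries_pow`).

Everything about `P` and `Q` comes from one count (`card_oddReps_zmod_two`): for odd `m` the number
of odd positive solutions of `x ^ 2 + 3 * y ^ 2 = 4 * m` has the parity of `[m = k ^ 2] +
[m = 3 * k ^ 2]`, since multiplying `x + y√-3` by a sixth root of unity pairs off the others.
With Euler's pentagonal number theorem it gives `P ^ 3 = ∑ X ^ (k (k + 1) / 2)` and the modular
equation `P ^ 3 * Q ^ 3 = P ^ 12 + X * Q ^ 12`. By the latter `F = P ^ 3 / Q = 1 / A` satisfies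
`F = F ^ 4 + X * Q ^ 8`, an equation whose only solution with constant coefficient `1` is
`Θ = 1 + ∑ X ^ (k ^ 2)`, the sum over `k ≥ 1` prime to 3. Hence `A * Θ = 1`, and
`A = A ^ 2 * Θ = Θ ^ 2 + X * (A * Q ^ 4) ^ 2`, which is the dissection of `A` into even and odd
exponents. Repeating it, the series of `a(2 n)`, `a(4 n + 1)` and `a(8 n + 3)` are `Θ`, `Θ * Q ^ 2`
and `Θ * Q ^ 3`: if `n` is not `7` modulo 8 and `a(n)` is odd, then `n` has the form
`u ^ 2 + v ^ 2` or `3 * u ^ 2 + 2 * v ^ 2` (`exists_form_of_odd_oddMultPartitionCount`).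

Neither `-1` nor `-6` is a square modulo a prime `p ≡ 23` modulo 24, so such a prime never divides a
value of one of these forms exactly once. The reciprocals of these primes have a divergent sum,
which follows from the pole at `1` behind Dirichlet's theorem
(`not_summable_one_div_primes_eq_mod`), and a sieve by finitely many of them shows that such `n`
have density zero (`hasNaturalDensity_zero_of_noSimpleFactor`).
-/

/-! ### Odd representations by the form `x² + 3y²` -/

/-- The pairs of odd natural numbers `(x, y)` with `x ^ 2 + 3 * y ^ 2 = 4 * m`. -/
def oddReps (m : ℕ) : Finset (ℕ × ℕ) :=
  (Finset.range (4 * m + 1) ×ˢ Finset.range (4 * m + 1)).filter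
    fun z => Odd z.1 ∧ Odd z.2 ∧ z.1 ^ 2 + 3 * z.2 ^ 2 = 4 * m

lemma mem_oddReps {m : ℕ} {z : ℕ × ℕ} :
    z ∈ oddReps m ↔ Odd z.1 ∧ Odd z.2 ∧ z.1 ^ 2 + 3 * z.2 ^ 2 = 4 * m := by
  simp only [oddReps, Finset.mem_filter, Finset.mem_product, Finset.mem_range,
    and_iff_right_iff_imp]
  rintro ⟨-, -, h⟩
  constructor <;> nlinarith

/-- Multiplication of `x + y√-3` by a primitive sixth root of unity, up to conjugation and the
signs of the coordinates; the root of unity is the one that keeps both coordinates odd. -/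
def eisensteinFlip (z : ℕ × ℕ) : ℕ × ℕ :=
  if z.1 % 4 = z.2 % 4 then (((z.1 - 3 * z.2) + (3 * z.2 - z.1)) / 2, (z.1 + z.2) / 2)
  else ((z.1 + 3 * z.2) / 2, ((z.1 - z.2) + (z.2 - z.1)) / 2)

lemma eisensteinFlip_eisensteinFlip {z : ℕ × ℕ} (h1 : Odd z.1) (h2 : Odd z.2) :
    eisensteinFlip (eisensteinFlip z) = z := by
  obtain ⟨x, y⟩ := z
  simp only [Nat.odd_iff] at h1 h2
  by_cases h : x % 4 = y % 4
  · rw [show eisensteinFlip (x, y) = _ from if_pos h]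
    by_cases h' : 3 * y ≤ x
    · rw [eisensteinFlip, if_neg (by dsimp only; omega)]
      ext <;> dsimp only <;> omega
    · rw [eisensteinFlip, if_pos (by dsimp only; omega)]
      ext <;> dsimp only <;> omega
  · rw [show eisensteinFlip (x, y) = _ from if_neg h]
    by_cases h' : y ≤ x
    · rw [eisensteinFlip, if_neg (by dsimp only; omega)]
      ext <;> dsimp only <;> omega
    · rw [eisensteinFlip, if_pos (by dsimp only; omega)]
      ext <;> dsimp only <;> omega

lemma eisensteinFlip_mem_oddReps {m : ℕ} {z : ℕ × ℕ} (hz : z ∈ oddReps m) :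
    eisensteinFlip z ∈ oddReps m := by
  rw [mem_oddReps] at hz ⊢
  obtain ⟨x, y⟩ := z
  obtain ⟨h1, h2, h3⟩ := hz
  simp only [Nat.odd_iff] at h1 h2 h3 ⊢
  have h3' : (x : ℤ) ^ 2 + 3 * (y : ℤ) ^ 2 = 4 * m := by exact_mod_cast h3
  have key : ∀ x' y' : ℕ, ((2 * x' : ℤ) = x - 3 * y ∨ (2 * x' : ℤ) = 3 * y - x) →
      (2 * y' : ℤ) = x + y → x' ^ 2 + 3 * y' ^ 2 = 4 * m := by
    intro x' y' hx hy
    zify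
    have : (2 * (x' : ℤ)) ^ 2 = (x - 3 * y) ^ 2 := by
      rcases hx with hx | hx
      · rw [hx]
      · rw [hx]; ring
    have : (2 * (y' : ℤ)) ^ 2 = (x + y) ^ 2 := by rw [hy]
    linarith
  have key' : ∀ x' y' : ℕ, ((2 * y' : ℤ) = x - y ∨ (2 * y' : ℤ) = y - x) →
      (2 * x' : ℤ) = x + 3 * y → x' ^ 2 + 3 * y' ^ 2 = 4 * m := by
    intro x' y' hy hx
    zify
    have : (2 * (y' : ℤ)) ^ 2 = (x - y) ^ 2 := by
      rcases hy with hy | hy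
      · rw [hy]
      · rw [hy]; ring
    have : (2 * (x' : ℤ)) ^ 2 = (x + 3 * y) ^ 2 := by rw [hx]
    linarith
  by_cases h : x % 4 = y % 4
  · rw [show eisensteinFlip (x, y) = _ from if_pos h]
    exact ⟨by dsimp only; omega, by dsimp only; omega, key _ _ (by omega) (by omega)⟩
  · rw [show eisensteinFlip (x, y) = _ from if_neg h]
    exact ⟨by dsimp only; omega, by dsimp only; omega, key' _ _ (by omega) (by omega)⟩

lemma eisensteinFlip_eq_self_iff {z : ℕ × ℕ} (h1 : Odd z.1) (h2 : Odd z.2) :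
    eisensteinFlip z = z ↔ z.1 = z.2 ∨ z.1 = 3 * z.2 := by
  obtain ⟨x, y⟩ := z
  simp only [Nat.odd_iff] at h1 h2 ⊢
  by_cases h : x % 4 = y % 4
  · rw [show eisensteinFlip (x, y) = _ from if_pos h, Prod.mk.injEq]
    dsimp only
    omega
  · rw [show eisensteinFlip (x, y) = _ from if_neg h, Prod.mk.injEq]
    dsimp only
    omega

/-- The fixed points of `eisensteinFlip` are the representations `(k, k)` of `4 * k ^ 2` and
`(3 * k, k)` of `4 * (3 * k ^ 2)`, and all others pair off. -/
lemma card_oddReps_zmod_two {m : ℕ} [Decidable (∃ k, m = 3 * k ^ 2)] (hm : Odd m) :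
    ((oddReps m).card : ZMod 2) =
      (if IsSquare m then 1 else 0) + if ∃ k, m = 3 * k ^ 2 then 1 else 0 := by
  classical
  have hodd : ∀ k, m = k ^ 2 ∨ m = 3 * k ^ 2 → Odd k := by
    rintro k (rfl | rfl)
    · exact (Nat.odd_pow_iff two_ne_zero).1 hm
    · exact (Nat.odd_pow_iff two_ne_zero).1 (Nat.odd_mul.1 hm).2
  have hmoved : (∑ z ∈ (oddReps m).filter fun z => ¬ eisensteinFlip z = z, (1 : ZMod 2)) = 0 := by
    refine Finset.sum_involution (fun z _ => eisensteinFlip z) (fun _ _ => by decide)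
      (fun z hz _ => (Finset.mem_filter.1 hz).2) (fun z hz => ?_) (fun z hz => ?_)
    · obtain ⟨hz, hz'⟩ := Finset.mem_filter.1 hz
      obtain ⟨h1, h2, -⟩ := mem_oddReps.1 hz
      refine Finset.mem_filter.2 ⟨eisensteinFlip_mem_oddReps hz, ?_⟩
      rw [eisensteinFlip_eisensteinFlip h1 h2]
      exact fun h => hz' h.symm
    · obtain ⟨h1, h2, -⟩ := mem_oddReps.1 (Finset.mem_filter.1 hz).1
      exact eisensteinFlip_eisensteinFlip h1 h2
  have hfix : (oddReps m).filter (fun z => eisensteinFlip z = z) =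
      (oddReps m).filter (fun z => z.1 = z.2) ∪ (oddReps m).filter (fun z => z.1 = 3 * z.2) := by
    rw [← Finset.filter_or]
    refine Finset.filter_congr fun z hz => ?_
    obtain ⟨h1, h2, -⟩ := mem_oddReps.1 hz
    exact eisensteinFlip_eq_self_iff h1 h2
  have hdisj : Disjoint ((oddReps m).filter (fun z => z.1 = z.2))
      ((oddReps m).filter (fun z => z.1 = 3 * z.2)) := by
    rw [Finset.disjoint_filter]
    intro z hz h h'
    have := (mem_oddReps.1 hz).2.1.pos
    omega
  have hdiag : ((oddReps m).filter (fun z => z.1 = z.2)).card = if IsSquare m then 1 else 0 := by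
    split_ifs with h
    · obtain ⟨k, hk⟩ := h
      have := hodd k (Or.inl (by rw [hk, sq]))
      refine Finset.card_eq_one.2 ⟨(k, k), ?_⟩
      ext ⟨x, y⟩
      simp only [Finset.mem_filter, mem_oddReps, Finset.mem_singleton, Prod.mk.injEq]
      constructor
      · rintro ⟨⟨-, -, h⟩, rfl⟩
        have : x ^ 2 = k ^ 2 := by nlinarith
        have : x = k := by simpa using this
        exact ⟨this, this⟩
      · rintro ⟨rfl, rfl⟩
        exact ⟨⟨this, this, by rw [hk]; ring⟩, rfl⟩
    · rw [Finset.card_eq_zero, Finset.filter_eq_empty_iff]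
      rintro ⟨x, y⟩ hz (rfl : x = y)
      obtain ⟨-, -, hz⟩ := mem_oddReps.1 hz
      exact h ⟨x, by dsimp only at hz; nlinarith⟩
  have htriple : ((oddReps m).filter (fun z => z.1 = 3 * z.2)).card =
      if ∃ k, m = 3 * k ^ 2 then 1 else 0 := by
    split_ifs with h
    · obtain ⟨k, hk⟩ := h
      have hk' := hodd k (Or.inr hk)
      refine Finset.card_eq_one.2 ⟨(3 * k, k), ?_⟩
      ext ⟨x, y⟩
      simp only [Finset.mem_filter, mem_oddReps, Finset.mem_singleton, Prod.mk.injEq]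
      constructor
      · rintro ⟨⟨-, -, h⟩, rfl⟩
        have : y ^ 2 = k ^ 2 := by nlinarith
        have : y = k := by simpa using this
        exact ⟨by rw [this], this⟩
      · rintro ⟨rfl, rfl⟩
        exact ⟨⟨Odd.mul (by decide) hk', hk', by rw [hk]; ring⟩, rfl⟩
    · rw [Finset.card_eq_zero, Finset.filter_eq_empty_iff]
      rintro ⟨x, y⟩ hz (rfl : x = 3 * y)
      obtain ⟨-, -, hz⟩ := mem_oddReps.1 hz
      exact h ⟨y, by dsimp only at hz; nlinarith⟩
  rw [Finset.sum_const, nsmul_one] at hmoved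
  rw [← Finset.card_filter_add_card_filter_not (s := oddReps m) (fun z => eisensteinFlip z = z),
    Nat.cast_add, hmoved, add_zero, hfix, Finset.card_union_of_disjoint hdisj, hdiag, htriple]
  push_cast
  rfl

/-! ### Theta series modulo 2 -/

/-- `∑ X ^ (k (k + 1) / 2)` modulo 2; a number `n` is triangular iff `8 * n + 1` is a square. -/
noncomputable def triangularSeries : PowerSeries (ZMod 2) :=
  PowerSeries.mk fun n => if IsSquare (8 * n + 1) then 1 else 0

/-- The series `1 + ∑ X ^ (k ^ 2)` modulo 2, over the `k ≥ 1` prime to 3. -/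
noncomputable def squareSeries : PowerSeries (ZMod 2) :=
  PowerSeries.mk fun n => if n = 0 ∨ IsSquare n ∧ ¬ 3 ∣ n then 1 else 0

/-- `∏ (1 - X ^ n)` modulo 2, which is `∑ X ^ (k * (3 * k - 1) / 2)` over all integers `k`. -/
noncomputable abbrev eulerSeries : PowerSeries (ZMod 2) := PowerSeries.pentagonalSeries (ZMod 2)

/-- `∏ (1 - X ^ (3 * n))` modulo 2. -/
noncomputable abbrev eulerSeriesThree : PowerSeries (ZMod 2) :=
  PowerSeries.expand 3 three_ne_zero eulerSeries

/-- A number `n` is a generalized pentagonal number iff `24 * n + 1` is a square. -/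
lemma coeff_eulerSeries (n : ℕ) :
    eulerSeries.coeff n = if IsSquare (24 * n + 1) then 1 else 0 := by
  split_ifs with h
  · obtain ⟨r, hr⟩ := h
    have hmod : r % 6 = 1 ∨ r % 6 = 5 := by
      have h6 : r * r % 6 = 1 := by omega
      have : r % 6 < 6 := Nat.mod_lt _ (by norm_num)
      rw [Nat.mul_mod] at h6
      interval_cases r % 6 <;> simp_all
    have key : ∃ k : ℤ, (r : ℤ) ^ 2 = (6 * k - 1) ^ 2 := by
      rcases hmod with h | h
      · exact ⟨-(r / 6 : ℕ), by rw [← neg_sq]; congr 1; omega⟩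
      · exact ⟨(r / 6 : ℕ) + 1, by congr 1; omega⟩
    obtain ⟨k, hk⟩ := key
    have h1 := two_mul_natCast_pentagonal k
    have h2 : (24 * n + 1 : ℤ) = r * r := by exact_mod_cast hr
    have : n = pentagonal k := by
      zify
      nlinarith
    rw [this, PowerSeries.coeff_pentagonalSeries_pentagonal]
    rcases Int.even_or_odd k with hk | hk
    · simp [Int.negOnePow_even k hk]
    · simp [Int.negOnePow_odd k hk]
  · refine PowerSeries.coeff_pentagonalSeries_eq_zero _ ?_
    rintro ⟨k, rfl⟩
    refine h ⟨(6 * k - 1).natAbs, ?_⟩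
    have h1 := two_mul_natCast_pentagonal k
    zify
    rw [abs_mul_abs_self]
    linarith

lemma sq_eq_expand (f : PowerSeries (ZMod 2)) : f ^ 2 = PowerSeries.expand 2 two_ne_zero f := by
  have := MvPowerSeries.map_frobenius_expand (σ := Unit) 2 two_ne_zero (f := f)
  rw [ZMod.frobenius_zmod, MvPowerSeries.map_id] at this
  exact this.symm

lemma coeff_sq (f : PowerSeries (ZMod 2)) (n : ℕ) :
    (f ^ 2).coeff n = if 2 ∣ n then f.coeff (n / 2) else 0 := by
  rw [sq_eq_expand, PowerSeries.coeff_expand]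

lemma coeff_pow_four (f : PowerSeries (ZMod 2)) (n : ℕ) :
    (f ^ 4).coeff n = if 4 ∣ n then f.coeff (n / 4) else 0 := by
  rw [show f ^ 4 = PowerSeries.expand (2 * 2) four_ne_zero f by
    rw [PowerSeries.expand_mul 2 two_ne_zero 2 two_ne_zero, ← sq_eq_expand, ← sq_eq_expand,
      ← pow_mul], PowerSeries.coeff_expand]

/-- The coefficients of a product of two indicator series count representations. -/
lemma coeff_mul_of_indicator {f g : PowerSeries (ZMod 2)} {p q : ℕ → Prop} [DecidablePred p]
    [DecidablePred q] (hf : ∀ n, f.coeff n = if p n then 1 else 0)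
    (hg : ∀ n, g.coeff n = if q n then 1 else 0) (n : ℕ) :
    (f * g).coeff n =
      (((Finset.HasAntidiagonal.antidiagonal n).filter fun z => p z.1 ∧ q z.2).card : ZMod 2) := by
  simp only [PowerSeries.coeff_mul, hf, hg, ite_zero_mul_ite_zero, mul_one]
  rw [Finset.sum_boole]

lemma exists_sq_eq_of_odd {x : ℕ} (hx : Odd x) : ∃ t, x ^ 2 = 8 * t + 1 := by
  obtain ⟨k, rfl⟩ := hx
  obtain ⟨t, ht⟩ := (Nat.even_mul_succ_self k).two_dvd
  exact ⟨t, by nlinarith⟩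

lemma sqrt_sq_of_isSquare {n : ℕ} (h : IsSquare n) : n.sqrt ^ 2 = n := by
  obtain ⟨r, rfl⟩ := h
  rw [Nat.sqrt_eq, sq]

lemma odd_of_sq_eq {x t : ℕ} (h : x ^ 2 = 2 * t + 1) : Odd x :=
  (Nat.odd_pow_iff two_ne_zero).1 (h ▸ odd_two_mul_add_one t)

lemma coeff_triangularSeries (n : ℕ) :
    triangularSeries.coeff n = if IsSquare (8 * n + 1) then 1 else 0 :=
  PowerSeries.coeff_mk _ _

/-- The coefficients of `X ^ n` are the parity of the number of odd positive solutions of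
`x ^ 2 + 3 * y ^ 2 = 4 * (6 * n + 1)`. -/
lemma triangularSeries_mul_eulerSeries :
    triangularSeries * eulerSeries = eulerSeries ^ 4 := by
  classical
  ext n
  have hcard : ((Finset.HasAntidiagonal.antidiagonal n).filter
      fun z => IsSquare (8 * z.1 + 1) ∧ IsSquare (24 * z.2 + 1)).card =
      (oddReps (6 * n + 1)).card := by
    refine Finset.card_nbij' (fun z => ((24 * z.2 + 1).sqrt, (8 * z.1 + 1).sqrt))
      (fun z => ((z.2 ^ 2 - 1) / 8, (z.1 ^ 2 - 1) / 24)) ?_ ?_ ?_ ?_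
    · rintro ⟨i, j⟩ hz
      simp only [Finset.coe_filter, Finset.HasAntidiagonal.mem_antidiagonal, Set.mem_ofPred_eq] at hz
      obtain ⟨rfl, hi, hj⟩ := hz
      have hi := sqrt_sq_of_isSquare hi
      have hj := sqrt_sq_of_isSquare hj
      rw [Finset.mem_coe, mem_oddReps]
      dsimp only
      exact ⟨odd_of_sq_eq (t := 12 * j) (by omega), odd_of_sq_eq (t := 4 * i) (by omega), by omega⟩
    · rintro ⟨x, y⟩ hz
      rw [Finset.mem_coe, mem_oddReps] at hz
      obtain ⟨hx, hy, h⟩ := hz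
      obtain ⟨s, hs⟩ := exists_sq_eq_of_odd hx
      obtain ⟨t, ht⟩ := exists_sq_eq_of_odd hy
      simp only [Finset.coe_filter, Finset.HasAntidiagonal.mem_antidiagonal, Set.mem_ofPred_eq]
      dsimp only at *
      refine ⟨by omega, ?_, ?_⟩
      · rw [show 8 * ((y ^ 2 - 1) / 8) + 1 = y ^ 2 by omega]
        exact IsSquare.sq y
      · rw [show 24 * ((x ^ 2 - 1) / 24) + 1 = x ^ 2 by omega]
        exact IsSquare.sq x
    · rintro ⟨i, j⟩ hz
      simp only [Finset.coe_filter, Finset.HasAntidiagonal.mem_antidiagonal, Set.mem_ofPred_eq] at hz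
      obtain ⟨rfl, hi, hj⟩ := hz
      have hi := sqrt_sq_of_isSquare hi
      have hj := sqrt_sq_of_isSquare hj
      ext <;> dsimp only <;> omega
    · rintro ⟨x, y⟩ hz
      rw [Finset.mem_coe, mem_oddReps] at hz
      obtain ⟨hx, hy, h⟩ := hz
      obtain ⟨s, hs⟩ := exists_sq_eq_of_odd hx
      obtain ⟨t, ht⟩ := exists_sq_eq_of_odd hy
      dsimp only at *
      rw [show 8 * ((y ^ 2 - 1) / 8) + 1 = y ^ 2 by omega,
        show 24 * ((x ^ 2 - 1) / 24) + 1 = x ^ 2 by omega, Nat.sqrt_eq', Nat.sqrt_eq']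
  rw [coeff_mul_of_indicator coeff_triangularSeries coeff_eulerSeries, hcard,
    card_oddReps_zmod_two (by rw [Nat.odd_iff]; omega), if_neg (c := ∃ k, _) (by omega), add_zero,
    coeff_pow_four, coeff_eulerSeries]
  by_cases h4 : 4 ∣ n
  · rw [if_pos h4, show 24 * (n / 4) + 1 = 6 * n + 1 by omega]
  · rw [if_neg h4, if_neg]
    rintro ⟨r, hr⟩
    rw [← sq] at hr
    obtain ⟨t, ht⟩ := exists_sq_eq_of_odd (odd_of_sq_eq (x := r) (t := 3 * n) (by omega))
    omega

/-- Jacobi's formula for the cube of the Euler product, modulo 2. -/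
lemma triangularSeries_eq : triangularSeries = eulerSeries ^ 3 := by
  have h0 : eulerSeries ≠ 0 := fun h => by
    have := coeff_eulerSeries 0
    simp [h] at this
  exact mul_right_cancel₀ h0 (triangularSeries_mul_eulerSeries.trans (pow_succ _ 3))

lemma coeff_expand_three_triangularSeries (n : ℕ) :
    (PowerSeries.expand 3 three_ne_zero triangularSeries).coeff n =
      if 3 ∣ n ∧ IsSquare (8 * (n / 3) + 1) then 1 else 0 := by
  rw [PowerSeries.coeff_expand, ite_and, coeff_triangularSeries]

/-- The coefficients of `X ^ n` are the parity of the number of odd positive solutions of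
`x ^ 2 + 3 * y ^ 2 = 4 * (2 * n + 1)`. -/
lemma triangularSeries_mul_expand_three :
    triangularSeries * PowerSeries.expand 3 three_ne_zero triangularSeries =
      triangularSeries ^ 4 +
        PowerSeries.X * (PowerSeries.expand 3 three_ne_zero triangularSeries) ^ 4 := by
  classical
  ext n
  have hcard : ((Finset.HasAntidiagonal.antidiagonal n).filter
      fun z => IsSquare (8 * z.1 + 1) ∧ 3 ∣ z.2 ∧ IsSquare (8 * (z.2 / 3) + 1)).card =
      (oddReps (2 * n + 1)).card := by
    refine Finset.card_nbij' (fun z => ((8 * z.1 + 1).sqrt, (8 * (z.2 / 3) + 1).sqrt))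
      (fun z => ((z.1 ^ 2 - 1) / 8, 3 * ((z.2 ^ 2 - 1) / 8))) ?_ ?_ ?_ ?_
    · rintro ⟨i, j⟩ hz
      simp only [Finset.coe_filter, Finset.HasAntidiagonal.mem_antidiagonal, Set.mem_ofPred_eq] at hz
      obtain ⟨rfl, hi, h3, hj⟩ := hz
      have hi := sqrt_sq_of_isSquare hi
      have hj := sqrt_sq_of_isSquare hj
      rw [Finset.mem_coe, mem_oddReps]
      dsimp only
      exact ⟨odd_of_sq_eq (t := 4 * i) (by omega), odd_of_sq_eq (t := 4 * (j / 3)) (by omega),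
        by omega⟩
    · rintro ⟨x, y⟩ hz
      rw [Finset.mem_coe, mem_oddReps] at hz
      obtain ⟨hx, hy, h⟩ := hz
      obtain ⟨s, hs⟩ := exists_sq_eq_of_odd hx
      obtain ⟨t, ht⟩ := exists_sq_eq_of_odd hy
      simp only [Finset.coe_filter, Finset.HasAntidiagonal.mem_antidiagonal, Set.mem_ofPred_eq]
      dsimp only at *
      refine ⟨by omega, ?_, by omega, ?_⟩
      · rw [show 8 * ((x ^ 2 - 1) / 8) + 1 = x ^ 2 by omega]
        exact IsSquare.sq x
      · rw [show 8 * (3 * ((y ^ 2 - 1) / 8) / 3) + 1 = y ^ 2 by omega]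
        exact IsSquare.sq y
    · rintro ⟨i, j⟩ hz
      simp only [Finset.coe_filter, Finset.HasAntidiagonal.mem_antidiagonal, Set.mem_ofPred_eq] at hz
      obtain ⟨rfl, hi, h3, hj⟩ := hz
      have hi := sqrt_sq_of_isSquare hi
      have hj := sqrt_sq_of_isSquare hj
      ext <;> dsimp only <;> omega
    · rintro ⟨x, y⟩ hz
      rw [Finset.mem_coe, mem_oddReps] at hz
      obtain ⟨hx, hy, h⟩ := hz
      obtain ⟨s, hs⟩ := exists_sq_eq_of_odd hx
      obtain ⟨t, ht⟩ := exists_sq_eq_of_odd hy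
      dsimp only at *
      rw [show 8 * ((x ^ 2 - 1) / 8) + 1 = x ^ 2 by omega,
        show 8 * (3 * ((y ^ 2 - 1) / 8) / 3) + 1 = y ^ 2 by omega, Nat.sqrt_eq', Nat.sqrt_eq']
  rw [coeff_mul_of_indicator coeff_triangularSeries
    coeff_expand_three_triangularSeries, hcard, card_oddReps_zmod_two (odd_two_mul_add_one n),
    map_add, coeff_pow_four]
  congr 1
  · rw [coeff_triangularSeries]
    by_cases h4 : 4 ∣ n
    · rw [if_pos h4, show 8 * (n / 4) + 1 = 2 * n + 1 by omega]
    · rw [if_neg h4, if_neg]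
      rintro ⟨r, hr⟩
      rw [← sq] at hr
      obtain ⟨t, ht⟩ := exists_sq_eq_of_odd (odd_of_sq_eq hr.symm)
      omega
  · rcases n with _ | n
    · rw [PowerSeries.coeff_zero_X_mul, if_neg]
      omega
    · rw [PowerSeries.coeff_succ_X_mul, coeff_pow_four, coeff_expand_three_triangularSeries,
        ← ite_and]
      refine if_congr ⟨?_, ?_⟩ rfl rfl
      · rintro ⟨k, hk⟩
        have hodd : Odd k := by
          have : Odd (3 * k ^ 2) := hk ▸ odd_two_mul_add_one _
          exact (Nat.odd_pow_iff two_ne_zero).1 (Nat.odd_mul.1 this).2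
        obtain ⟨t, ht⟩ := exists_sq_eq_of_odd hodd
        refine ⟨by omega, by omega, ?_⟩
        rw [show 8 * (n / 4 / 3) + 1 = k ^ 2 by omega]
        exact IsSquare.sq k
      · rintro ⟨h4, h3, r, hr⟩
        rw [← sq] at hr
        exact ⟨r, by omega⟩

lemma eulerSeries_modular_equation :
    eulerSeries ^ 3 * eulerSeriesThree ^ 3 =
      eulerSeries ^ 12 + PowerSeries.X * eulerSeriesThree ^ 12 := by
  have h := triangularSeries_mul_expand_three
  rw [triangularSeries_eq, map_pow, ← pow_mul, ← pow_mul] at h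
  exact h

/-! ### The generating function modulo 2 -/

/-- The generating function of `oddMultPartitionCount` modulo 2. -/
noncomputable def oddMultSeries : PowerSeries (ZMod 2) :=
  PowerSeries.mk fun n => (oddMultPartitionCount n : ZMod 2)

lemma coeff_oddMultSeries (n : ℕ) :
    oddMultSeries.coeff n = (oddMultPartitionCount n : ZMod 2) :=
  PowerSeries.coeff_mk _ _

lemma oddMultSeries_eq_genFun :
    oddMultSeries = Nat.Partition.genFun fun _ c => if Odd c then (1 : ZMod 2) else 0 := by
  ext n
  simp only [coeff_oddMultSeries, oddMultPartitionCount, Nat.Partition.coeff_genFun,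
    Finset.card_filter, Finsupp.prod, Finset.prod_boole]
  simp

open PowerSeries PowerSeries.WithPiTopology in
/-- The factor `1 + Y + Y ^ 3 + Y ^ 5 + ⋯` of the generating function, with `Y = X ^ (i + 1)`, is
`(1 - Y ^ 3) / (1 - Y) ^ 3` modulo 2. -/
lemma oddMult_factor [TopologicalSpace (ZMod 2)] [DiscreteTopology (ZMod 2)] (i : ℕ) :
    (1 + ∑' j : ℕ, (if Odd (j + 1) then (1 : ZMod 2) else 0) •
      (X : PowerSeries (ZMod 2)) ^ ((i + 1) * (j + 1))) * (1 - X ^ (i + 1)) ^ 3 =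
      1 - X ^ (3 * (i + 1)) := by
  set Y : PowerSeries (ZMod 2) := X ^ (i + 1) with hY
  have hY0 : (Y ^ 2).constantCoeff = 0 := by simp [hY]
  have hsum : (∑' j : ℕ, (if Odd (j + 1) then (1 : ZMod 2) else 0) •
      (X : PowerSeries (ZMod 2)) ^ ((i + 1) * (j + 1))) = Y * ∑' j : ℕ, (Y ^ 2) ^ j := by
    rw [← (summable_pow_of_constantCoeff_eq_zero hY0).tsum_mul_left]
    refine tsum_eq_tsum_of_ne_zero_bij (fun j => 2 * j.1) ?_ ?_ ?_
    · intro a b h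
      exact Subtype.ext (by simpa using h)
    · intro j hj
      have hj : Odd (j + 1) := by
        by_contra h
        exact hj (by simp only [if_neg h, zero_smul])
      obtain ⟨k, hk⟩ := hj
      refine ⟨⟨k, ?_⟩, by simp; omega⟩
      rw [Function.mem_support, ← pow_mul, ← pow_succ', hY, ← pow_mul]
      exact pow_ne_zero _ X_ne_zero
    · intro j
      rw [if_pos (odd_two_mul_add_one _), one_smul, pow_mul, ← hY, ← pow_mul Y 2, ← pow_succ']
  have hgeom := tsum_pow_mul_one_sub_of_constantCoeff_eq_zero hY0
  have h2 : (2 : PowerSeries (ZMod 2)) = 0 := by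
    rw [← map_ofNat (C (R := ZMod 2)) 2, show (OfNat.ofNat 2 : ZMod 2) = 0 from rfl, map_zero]
  rw [hsum, show (X : PowerSeries (ZMod 2)) ^ (3 * (i + 1)) = Y ^ 3 by rw [hY, ← pow_mul, mul_comm]]
  generalize ∑' j : ℕ, (Y ^ 2) ^ j = T at hgeom ⊢
  clear_value Y
  linear_combination (Y * (1 - Y)) * hgeom + (Y ^ 3 - Y ^ 2 - Y * (1 - Y) ^ 2 * (1 + Y * T)) * h2

open PowerSeries PowerSeries.WithPiTopology in
lemma oddMultSeries_mul_eulerSeries_pow : oddMultSeries * eulerSeries ^ 3 = eulerSeriesThree := by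
  let _ : TopologicalSpace (ZMod 2) := ⊥
  have _ : DiscreteTopology (ZMod 2) := ⟨rfl⟩
  have h1 := Nat.Partition.hasProd_genFun fun _ c => if Odd c then (1 : ZMod 2) else 0
  have h2 := hasProd_one_sub_X_pow (ZMod 2)
  have h3 := h1.mul (h2.mul (h2.mul h2))
  have hcont : Continuous (expand 3 three_ne_zero : PowerSeries (ZMod 2) →ₐ[ZMod 2] _) := by
    rw [continuous_iff_continuousAt]
    intro f
    refine (tendsto_iff_coeff_tendsto ..).2 fun d => ?_
    simp only [coeff_expand]
    split_ifs
    · exact (continuous_coeff (ZMod 2) _).continuousAt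
    · exact tendsto_const_nhds
  have h4 := h2.map (expand 3 three_ne_zero : PowerSeries (ZMod 2) →ₐ[ZMod 2] _) hcont
  rw [← oddMultSeries_eq_genFun] at h3
  rw [pow_succ', sq]
  refine h3.unique ?_
  convert! h4 using 1
  ext1 i
  rw [Function.comp_apply, map_sub, map_one, map_pow, expand_X, ← pow_mul, ← oddMult_factor]
  ring

lemma coeff_squareSeries (n : ℕ) :
    squareSeries.coeff n = if n = 0 ∨ IsSquare n ∧ ¬ 3 ∣ n then 1 else 0 :=
  PowerSeries.coeff_mk _ _

lemma isSquare_four_mul_iff {n : ℕ} : IsSquare (4 * n) ↔ IsSquare n := by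
  constructor
  · rintro ⟨r, hr⟩
    have hr2 : 2 ∣ r := by
      have : 2 ∣ r * r := ⟨2 * n, by omega⟩
      exact (Nat.prime_two.dvd_mul.1 this).elim id id
    obtain ⟨s, rfl⟩ := hr2
    exact ⟨s, by nlinarith⟩
  · exact fun h => IsSquare.mul ⟨2, rfl⟩ h

lemma coeff_eulerSeriesThree_pow_eight (n : ℕ) :
    (eulerSeriesThree ^ 8).coeff n = if 24 ∣ n ∧ IsSquare (n + 1) then 1 else 0 := by
  rw [show eulerSeriesThree ^ 8 = (eulerSeriesThree ^ 4) ^ 2 by rw [← pow_mul], coeff_sq,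
    coeff_pow_four, PowerSeries.coeff_expand, coeff_eulerSeries, ← ite_and, ← ite_and, ← ite_and]
  refine if_congr ⟨?_, ?_⟩ rfl rfl
  · rintro ⟨⟨⟨h1, h2⟩, h3⟩, h⟩
    exact ⟨by omega, by rwa [show n + 1 = 24 * (n / 2 / 4 / 3) + 1 by omega]⟩
  · rintro ⟨h1, h⟩
    exact ⟨⟨⟨by omega, by omega⟩, by omega⟩,
      by rwa [show 24 * (n / 2 / 4 / 3) + 1 = n + 1 by omega]⟩

/-- The squares prime to 3 are four times such squares or prime to 6, and the latter are the
numbers `24 * g + 1` with `g` a pentagonal number. -/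
lemma squareSeries_functional_equation :
    squareSeries = squareSeries ^ 4 + PowerSeries.X * eulerSeriesThree ^ 8 := by
  ext n
  rw [map_add, coeff_pow_four]
  rcases n with _ | n
  · rw [PowerSeries.coeff_zero_X_mul, if_pos (dvd_zero _), Nat.zero_div, add_zero]
  rw [PowerSeries.coeff_succ_X_mul, coeff_eulerSeriesThree_pow_eight]
  by_cases h4 : 4 ∣ n + 1
  · obtain ⟨k, hk⟩ := h4
    -- A multiple of `4` is not `1` more than a multiple of `24`.
    rw [if_pos (by omega), if_neg (c := 24 ∣ n ∧ _) (by omega), add_zero, hk,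
      Nat.mul_div_cancel_left _ (by norm_num), coeff_squareSeries, coeff_squareSeries]
    refine if_congr ?_ rfl rfl
    rw [isSquare_four_mul_iff, show 3 ∣ 4 * k ↔ 3 ∣ k by omega, show 4 * k = 0 ↔ k = 0 by omega]
  · rw [if_neg h4, zero_add, coeff_squareSeries]
    refine if_congr ⟨?_, ?_⟩ rfl rfl
    · rintro (h | ⟨h, h3⟩)
      · omega
      · refine ⟨?_, h⟩
        obtain ⟨r, hr⟩ := h
        have hodd : Odd r := by
          rw [← Nat.not_even_iff_odd]
          rintro ⟨s, rfl⟩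
          exact h4 ⟨s * s, by rw [hr]; ring⟩
        obtain ⟨t, ht⟩ := exists_sq_eq_of_odd hodd
        have hr3 : ¬ 3 ∣ r := fun h => h3 (hr ▸ Dvd.dvd.mul_left h r)
        have : r * r % 3 = 1 := by
          rw [Nat.mul_mod]
          have : r % 3 = 1 ∨ r % 3 = 2 := by omega
          rcases this with h | h <;> rw [h]
        rw [sq] at ht
        omega
    · rintro ⟨h, h'⟩
      exact Or.inr ⟨h', by omega⟩

/-- Both `squareSeries` and `(eulerSeries ^ 3) / eulerSeriesThree` solve
`F = F ^ 4 + X * eulerSeriesThree ^ 8` with constant coefficient `1`, and over a field of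
characteristic 2 there is only one such series. -/
lemma squareSeries_mul_eulerSeriesThree : squareSeries * eulerSeriesThree = eulerSeries ^ 3 := by
  have h2 : (2 : PowerSeries (ZMod 2)) = 0 := by
    rw [← map_ofNat (PowerSeries.C (R := ZMod 2)) 2, show (OfNat.ofNat 2 : ZMod 2) = 0 from rfl,
      map_zero]
  have hP0 : eulerSeries.constantCoeff = 1 := by
    rw [← PowerSeries.coeff_zero_eq_constantCoeff_apply, coeff_eulerSeries]
    simp
  have hQ0 : eulerSeriesThree.constantCoeff = 1 := by rw [PowerSeries.constantCoeff_expand, hP0]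
  have hS0 : squareSeries.constantCoeff = 1 := by
    rw [← PowerSeries.coeff_zero_eq_constantCoeff_apply, coeff_squareSeries]
    simp
  have hm := eulerSeries_modular_equation
  have hs := squareSeries_functional_equation
  have hQ : eulerSeriesThree ≠ 0 := fun h => by simp [h] at hQ0
  generalize eulerSeriesThree = Q at *
  generalize eulerSeries = P at *
  generalize squareSeries = S at *
  set D := S * Q - P ^ 3 with hD
  have hD0 : D.constantCoeff = 0 := by
    rw [hD, map_sub, map_mul, map_pow, hS0, hP0, hQ0, one_pow, mul_one, sub_self]
  have hfour : D ^ 4 = (S * Q) ^ 4 - (P ^ 3) ^ 4 := by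
    rw [hD]
    linear_combination
      (-2 * (S * Q) ^ 3 * P ^ 3 + 3 * (S * Q) ^ 2 * P ^ 6 - 2 * S * Q * P ^ 9 + P ^ 12) * h2
  have hzero : D * (Q ^ 3 - D ^ 3) = 0 := by
    linear_combination Q ^ 4 * hs - hm - hfour + (Q ^ 3) * hD
  rcases mul_eq_zero.1 hzero with h | h
  · exact sub_eq_zero.1 h
  · have := congrArg PowerSeries.constantCoeff h
    rw [map_sub, map_pow, map_pow, hD0, hQ0] at this
    simp at this

lemma oddMultSeries_mul_squareSeries : oddMultSeries * squareSeries = 1 := by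
  have hQ : eulerSeriesThree ≠ 0 := fun h => by
    have : eulerSeriesThree.constantCoeff = 1 := by
      rw [PowerSeries.constantCoeff_expand, ← PowerSeries.coeff_zero_eq_constantCoeff_apply,
        coeff_eulerSeries]
      simp
    simp [h] at this
  refine mul_right_cancel₀ hQ ?_
  rw [mul_assoc, squareSeries_mul_eulerSeriesThree, oddMultSeries_mul_eulerSeries_pow, one_mul]

/-- The dissection of the generating function into its even and its odd part. -/
lemma oddMultSeries_dissection :
    oddMultSeries =
      squareSeries ^ 2 + PowerSeries.X * (oddMultSeries * eulerSeriesThree ^ 4) ^ 2 := by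
  have h := oddMultSeries_mul_squareSeries
  have hs := squareSeries_functional_equation
  generalize eulerSeriesThree = Q at *
  generalize squareSeries = S at *
  generalize oddMultSeries = A at *
  linear_combination A ^ 2 * hs + (S ^ 2 * (A * S + 1) - A) * h

lemma coeff_two_mul_sq_add_X_mul_sq (f g : PowerSeries (ZMod 2)) (n : ℕ) :
    (f ^ 2 + PowerSeries.X * g ^ 2).coeff (2 * n) = f.coeff n := by
  rw [map_add, coeff_sq, if_pos (dvd_mul_right 2 n), Nat.mul_div_cancel_left _ two_pos]
  rcases n with _ | n
  · rw [mul_zero, PowerSeries.coeff_zero_X_mul, add_zero]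
  · rw [show 2 * (n + 1) = (2 * n + 1) + 1 by ring, PowerSeries.coeff_succ_X_mul, coeff_sq,
      if_neg (by omega), add_zero]

lemma coeff_two_mul_add_one_sq_add_X_mul_sq (f g : PowerSeries (ZMod 2)) (n : ℕ) :
    (f ^ 2 + PowerSeries.X * g ^ 2).coeff (2 * n + 1) = g.coeff n := by
  rw [map_add, coeff_sq, if_neg (by omega), zero_add, PowerSeries.coeff_succ_X_mul, coeff_sq,
    if_pos (dvd_mul_right 2 n), Nat.mul_div_cancel_left _ two_pos]

lemma oddMultPartitionCount_two_mul (n : ℕ) :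
    (oddMultPartitionCount (2 * n) : ZMod 2) = squareSeries.coeff n := by
  rw [← coeff_oddMultSeries, oddMultSeries_dissection, coeff_two_mul_sq_add_X_mul_sq]

lemma oddMultPartitionCount_two_mul_add_one (n : ℕ) :
    (oddMultPartitionCount (2 * n + 1) : ZMod 2) =
      (oddMultSeries * eulerSeriesThree ^ 4).coeff n := by
  rw [← coeff_oddMultSeries, oddMultSeries_dissection, coeff_two_mul_add_one_sq_add_X_mul_sq,
    ← oddMultSeries_dissection]

lemma oddMultPartitionCount_four_mul_add_one (n : ℕ) :
    (oddMultPartitionCount (4 * n + 1) : ZMod 2) =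
      (squareSeries * eulerSeriesThree ^ 2).coeff n := by
  rw [show 4 * n + 1 = 2 * (2 * n) + 1 by ring, oddMultPartitionCount_two_mul_add_one,
    show oddMultSeries * eulerSeriesThree ^ 4 = (squareSeries * eulerSeriesThree ^ 2) ^ 2 +
      PowerSeries.X * (oddMultSeries * eulerSeriesThree ^ 6) ^ 2 by
      linear_combination eulerSeriesThree ^ 4 * oddMultSeries_dissection,
    coeff_two_mul_sq_add_X_mul_sq]

lemma oddMultPartitionCount_eight_mul_add_three (n : ℕ) :
    (oddMultPartitionCount (8 * n + 3) : ZMod 2) =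
      (squareSeries * eulerSeriesThree ^ 3).coeff n := by
  rw [show 8 * n + 3 = 2 * (2 * (2 * n) + 1) + 1 by ring, oddMultPartitionCount_two_mul_add_one,
    show oddMultSeries * eulerSeriesThree ^ 4 = (squareSeries * eulerSeriesThree ^ 2) ^ 2 +
      PowerSeries.X * (oddMultSeries * eulerSeriesThree ^ 6) ^ 2 by
      linear_combination eulerSeriesThree ^ 4 * oddMultSeries_dissection,
    coeff_two_mul_add_one_sq_add_X_mul_sq,
    show oddMultSeries * eulerSeriesThree ^ 6 = (squareSeries * eulerSeriesThree ^ 3) ^ 2 +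
      PowerSeries.X * (oddMultSeries * eulerSeriesThree ^ 7) ^ 2 by
      linear_combination eulerSeriesThree ^ 6 * oddMultSeries_dissection,
    coeff_two_mul_sq_add_X_mul_sq]

lemma exists_add_of_coeff_mul_ne_zero {f g : PowerSeries (ZMod 2)} {n : ℕ}
    (h : (f * g).coeff n ≠ 0) : ∃ i j, i + j = n ∧ f.coeff i ≠ 0 ∧ g.coeff j ≠ 0 := by
  rw [PowerSeries.coeff_mul] at h
  obtain ⟨⟨i, j⟩, hij, h⟩ := Finset.exists_ne_zero_of_sum_ne_zero h
  exact ⟨i, j, Finset.HasAntidiagonal.mem_antidiagonal.1 hij, left_ne_zero_of_mul h,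
    right_ne_zero_of_mul h⟩

lemma isSquare_of_coeff_squareSeries_ne_zero {n : ℕ} (h : squareSeries.coeff n ≠ 0) :
    IsSquare n := by
  rw [coeff_squareSeries] at h
  rcases of_not_not fun h' => h (if_neg h') with rfl | h
  · exact IsSquare.zero
  · exact h.1

/-- An even `n` is twice a square here, and counts as a value of the second form. -/
lemma exists_form_of_odd_oddMultPartitionCount {n : ℕ} (h7 : ¬ n ≡ 7 [MOD 8])
    (h : Odd (oddMultPartitionCount n)) :
    (∃ u v, n = u ^ 2 + v ^ 2) ∨ ∃ u v, n = 3 * u ^ 2 + 2 * v ^ 2 := by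
  have h : (oddMultPartitionCount n : ZMod 2) ≠ 0 := by
    rw [ZMod.natCast_eq_one_iff_odd.2 h]
    exact one_ne_zero
  have hn : n % 2 = 0 ∨ n % 4 = 1 ∨ n % 8 = 3 := by
    rw [Nat.ModEq] at h7
    omega
  rcases hn with hn | hn | hn
  · obtain ⟨k, rfl⟩ : ∃ k, n = 2 * k := ⟨n / 2, by omega⟩
    rw [oddMultPartitionCount_two_mul] at h
    obtain ⟨r, rfl⟩ := isSquare_of_coeff_squareSeries_ne_zero h
    exact Or.inr ⟨0, r, by ring⟩
  · obtain ⟨k, rfl⟩ : ∃ k, n = 4 * k + 1 := ⟨n / 4, by omega⟩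
    rw [oddMultPartitionCount_four_mul_add_one] at h
    obtain ⟨i, j, rfl, hi, hj⟩ := exists_add_of_coeff_mul_ne_zero h
    obtain ⟨r, rfl⟩ := isSquare_of_coeff_squareSeries_ne_zero hi
    rw [coeff_sq, PowerSeries.coeff_expand, coeff_eulerSeries, ← ite_and, ← ite_and] at hj
    obtain ⟨⟨h2, h3⟩, s, hs⟩ := of_not_not fun h' => hj (if_neg h')
    refine Or.inl ⟨2 * r, s, ?_⟩
    rw [sq s, ← hs, mul_pow, sq r]
    omega
  · obtain ⟨k, rfl⟩ : ∃ k, n = 8 * k + 3 := ⟨n / 8, by omega⟩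
    rw [oddMultPartitionCount_eight_mul_add_three] at h
    obtain ⟨i, j, rfl, hi, hj⟩ := exists_add_of_coeff_mul_ne_zero h
    obtain ⟨r, rfl⟩ := isSquare_of_coeff_squareSeries_ne_zero hi
    rw [← map_pow, ← triangularSeries_eq, coeff_expand_three_triangularSeries] at hj
    obtain ⟨h3, s, hs⟩ := of_not_not fun h' => hj (if_neg h')
    refine Or.inr ⟨s, 2 * r, ?_⟩
    rw [sq s, ← hs, mul_pow, sq r]
    omega

/-! ### Reciprocals of the primes in a residue class -/

/-- The mean value inequality for the convex function `s ↦ 1 / n ^ s`. -/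
lemma sub_mul_log_div_rpow_le {n : ℕ} (hn : 0 < n) (s t : ℝ) :
    (t - s) * (Real.log n / (n : ℝ) ^ t) ≤ 1 / (n : ℝ) ^ s - 1 / (n : ℝ) ^ t := by
  have hn' : (0 : ℝ) < n := Nat.cast_pos.2 hn
  have h1 : 1 / (n : ℝ) ^ s = Real.exp ((t - s) * Real.log n) / (n : ℝ) ^ t := by
    rw [mul_comm, ← Real.rpow_def_of_pos hn', Real.rpow_sub hn']
    have := (Real.rpow_pos_of_pos hn' t).ne'
    field_simp
  rw [h1, mul_div_assoc', div_sub_div_same]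
  have := Real.add_one_le_exp ((t - s) * Real.log n)
  gcongr
  linarith

open ArithmeticFunction.vonMangoldt in
/-- The prime powers that are not prime contribute only a bounded amount to the Dirichlet series of
the von Mangoldt function on a residue class, so that the primes alone account for its pole. -/
lemma exists_tsum_log_div_rpow_lower_bound {q : ℕ} [NeZero q] {a : ZMod q} (ha : IsUnit a) :
    ∃ C : ℝ, 0 ≤ C ∧ ∀ x ∈ Set.Ioc (1 : ℝ) 2,
      Summable (fun n : ℕ => (if n.Prime then residueClass a n else 0) / (n : ℝ) ^ x) ∧
      (q.totient : ℝ)⁻¹ / (x - 1) - C ≤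
        ∑' n : ℕ, (if n.Prime then residueClass a n else 0) / (n : ℝ) ^ x := by
  obtain ⟨C, hC⟩ := LSeries_residueClass_lower_bound ha
  have hnp := summable_residueClass_non_primes_div a
  refine ⟨|C| + ∑' n : ℕ, (if n.Prime then 0 else residueClass a n) / (n : ℝ),
    add_nonneg (abs_nonneg C) (tsum_nonneg fun n => ?_), fun x hx => ?_⟩
  · have := residueClass_nonneg a n
    positivity
  have hall : Summable fun n : ℕ => residueClass a n / (n : ℝ) ^ x :=
    LSeries.summable_real_of_abscissaOfAbsConv_lt <|
      (abscissaOfAbsConv_residueClass_le_one a).trans_lt <| mod_cast hx.1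
  have hle : ∀ n : ℕ, (if n.Prime then 0 else residueClass a n) / (n : ℝ) ^ x ≤
      (if n.Prime then 0 else residueClass a n) / (n : ℝ) := by
    intro n
    have := residueClass_nonneg a n
    rcases n.eq_zero_or_pos with rfl | hn
    · simp
    · refine div_le_div_of_nonneg_left (by positivity) (mod_cast hn) ?_
      conv_lhs => rw [← Real.rpow_one n]
      exact Real.rpow_le_rpow_of_exponent_le (by norm_cast) hx.1.le
  have hnpx : Summable fun n : ℕ => (if n.Prime then 0 else residueClass a n) / (n : ℝ) ^ x :=
    hnp.of_nonneg_of_le (fun n => by have := residueClass_nonneg a n; positivity) hle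
  have hsub : (fun n : ℕ => (if n.Prime then residueClass a n else 0) / (n : ℝ) ^ x) = fun n : ℕ =>
      residueClass a n / (n : ℝ) ^ x - (if n.Prime then 0 else residueClass a n) / (n : ℝ) ^ x := by
    ext n
    split_ifs <;> simp
  rw [hsub]
  refine ⟨hall.sub hnpx, ?_⟩
  rw [hall.tsum_sub hnpx]
  have h1 := hC hx
  have h2 := hnpx.tsum_le_tsum hle hnp
  have h3 := le_abs_self C
  linarith

open ArithmeticFunction.vonMangoldt in
/-- The sum of the reciprocals of the primes in a reduced residue class diverges. If it converged,
`h s = ∑ 1 / p ^ s` would be bounded on `s > 1`; but `-h'` is at least `c / (s - 1) - C`, so that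
`h` grows by about `c / 2` from `1 + 2 ^ (-k)` to `1 + 2 ^ (-k - 1)`, for every `k`. -/
theorem not_summable_one_div_primes_eq_mod {q : ℕ} [NeZero q] {a : ZMod q} (ha : IsUnit a) :
    ¬ Summable fun n : ℕ => if n.Prime ∧ (n : ZMod q) = a then 1 / (n : ℝ) else 0 := by
  intro H
  obtain ⟨C, hC0, hC⟩ := exists_tsum_log_div_rpow_lower_bound ha
  set I : ℕ → ℝ := fun n => if n.Prime ∧ (n : ZMod q) = a then 1 else 0 with hI
  have hI0 : ∀ n, 0 ≤ I n := fun n => by simp only [hI]; positivity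
  have hI00 : I 0 = 0 := if_neg fun h => Nat.not_prime_zero h.1
  have hw : ∀ n : ℕ, (if n.Prime then residueClass a n else 0) = I n * Real.log n := by
    intro n
    by_cases hp : n.Prime <;> by_cases hna : (n : ZMod q) = a <;>
      simp [hI, hp, hna, residueClass, Set.indicator, ArithmeticFunction.vonMangoldt_apply_prime]
  have H' : Summable fun n : ℕ => I n / (n : ℝ) := by
    refine H.congr fun n => ?_
    simp only [hI, ite_div, zero_div]
  have hle : ∀ s : ℝ, 1 ≤ s → ∀ n : ℕ, I n / (n : ℝ) ^ s ≤ I n / (n : ℝ) := by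
    intro s hs n
    rcases n.eq_zero_or_pos with rfl | hn
    · simp [hI00]
    · refine div_le_div_of_nonneg_left (hI0 n) (mod_cast hn) ?_
      conv_lhs => rw [← Real.rpow_one n]
      exact Real.rpow_le_rpow_of_exponent_le (by norm_cast) hs
  have hsum : ∀ s : ℝ, 1 ≤ s → Summable fun n : ℕ => I n / (n : ℝ) ^ s := fun s hs =>
    H'.of_nonneg_of_le (fun n => div_nonneg (hI0 n) (by positivity)) (hle s hs)
  set h : ℝ → ℝ := fun s => ∑' n : ℕ, I n / (n : ℝ) ^ s with hh
  have hstep : ∀ s t : ℝ, 1 ≤ s → t ∈ Set.Ioc (1 : ℝ) 2 → s ≤ t →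
      h s ≥ h t + (t - s) * ((q.totient : ℝ)⁻¹ / (t - 1) - C) := by
    intro s t hs ht hst
    obtain ⟨hS, hL⟩ := hC t ht
    simp only [hw] at hS hL
    have h1 : (t - s) * ∑' n : ℕ, I n * Real.log n / (n : ℝ) ^ t ≤ h s - h t := by
      rw [hh, ← tsum_mul_left, ← (hsum s hs).tsum_sub (hsum t ht.1.le)]
      refine (hS.mul_left _).tsum_le_tsum (fun n => ?_) ((hsum s hs).sub (hsum t ht.1.le))
      rcases n.eq_zero_or_pos with rfl | hn
      · simp [hI00]
      · have := mul_le_mul_of_nonneg_left (sub_mul_log_div_rpow_le hn s t) (hI0 n)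
        calc _ = I n * ((t - s) * (Real.log n / (n : ℝ) ^ t)) := by ring
          _ ≤ _ := this
          _ = _ := by ring
    have h2 := mul_le_mul_of_nonneg_left hL (sub_nonneg.2 hst)
    linarith
  -- Summing the steps from `1 + 2 ^ (-j)` to `1 + 2 ^ (-j - 1)` over `j < k`.
  have hgrow : ∀ k : ℕ, k * ((q.totient : ℝ)⁻¹ / 2) - C * (1 - (1 / 2) ^ k) ≤
      h (1 + (1 / 2) ^ k) := by
    intro k
    induction k with
    | zero => simpa [hh] using tsum_nonneg fun n : ℕ => div_nonneg (hI0 n) (by positivity)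
    | succ k ih =>
      have hpos : (0 : ℝ) < (1 / 2) ^ k := by positivity
      have hle1 : ((1 : ℝ) / 2) ^ k ≤ 1 := pow_le_one₀ (by norm_num) (by norm_num)
      have := hstep (1 + (1 / 2) ^ (k + 1)) (1 + (1 / 2) ^ k) (by simp)
        ⟨by linarith, by linarith⟩ (by rw [pow_succ]; linarith)
      have h2 : ((1 : ℝ) + (1 / 2) ^ k - (1 + (1 / 2) ^ (k + 1))) *
          ((q.totient : ℝ)⁻¹ / (1 + (1 / 2) ^ k - 1) - C) =
          (q.totient : ℝ)⁻¹ / 2 - C * (1 / 2) ^ (k + 1) := by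
        rw [pow_succ, add_sub_cancel_left]
        field_simp
        ring
      rw [h2] at this
      rw [pow_succ] at this ⊢
      push_cast
      linarith
  have hq : 0 < (q.totient : ℝ)⁻¹ / 2 :=
    half_pos (inv_pos.2 (mod_cast q.totient.pos_of_neZero))
  obtain ⟨k, hk⟩ := exists_nat_gt ((C + ∑' n : ℕ, I n / (n : ℝ)) / ((q.totient : ℝ)⁻¹ / 2))
  rw [div_lt_iff₀ hq] at hk
  have h1 := hgrow k
  have h2 : h (1 + (1 / 2) ^ k) ≤ ∑' n : ℕ, I n / (n : ℝ) :=
    (hsum _ (by simp)).tsum_le_tsum (hle _ (by simp)) H'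
  have h3 : 0 ≤ C * (1 / 2) ^ k := by positivity
  linarith

/-! ### Integers with no simple prime factor in a given set -/

/-- `n` has no prime factor from `T` that divides it exactly once. -/
def NoSimpleFactor (T : Finset ℕ) (n : ℕ) : Prop := ∀ p ∈ T, p ∣ n → p ^ 2 ∣ n

lemma noSimpleFactor_mod_iff {T : Finset ℕ} {M : ℕ} (hM : ∀ p ∈ T, p ^ 2 ∣ M) (n : ℕ) :
    NoSimpleFactor T (n % M) ↔ NoSimpleFactor T n := by
  refine forall₂_congr fun p hp => ?_
  rw [Nat.dvd_mod_iff (hM p hp), Nat.dvd_mod_iff ((dvd_pow_self p two_ne_zero).trans (hM p hp))]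

lemma card_filter_range_mul_of_coprime {m n : ℕ} (hm : m ≠ 0) (hn : n ≠ 0) (h : m.Coprime n)
    {P Q : ℕ → Prop} [DecidablePred P] [DecidablePred Q] (hP : ∀ k, P (k % m) ↔ P k)
    (hQ : ∀ k, Q (k % n) ↔ Q k) :
    ((Finset.range (m * n)).filter fun k => P k ∧ Q k).card =
      ((Finset.range m).filter P).card * ((Finset.range n).filter Q).card := by
  rw [← Finset.card_product]
  refine Finset.card_nbij (fun k => (k % m, k % n)) ?_ ?_ ?_
  · intro k hk
    obtain ⟨-, h1, h2⟩ := Finset.mem_filter.1 hk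
    rw [Finset.mem_coe, Finset.mem_product, Finset.mem_filter, Finset.mem_filter,
      Finset.mem_range, Finset.mem_range, hP, hQ]
    exact ⟨⟨Nat.mod_lt _ (Nat.pos_of_ne_zero hm), h1⟩, Nat.mod_lt _ (Nat.pos_of_ne_zero hn), h2⟩
  · intro k hk l hl hkl
    rw [Prod.mk.injEq] at hkl
    have hk := Finset.mem_range.1 (Finset.mem_filter.1 hk).1
    have hl := Finset.mem_range.1 (Finset.mem_filter.1 hl).1
    exact Nat.ModEq.eq_of_lt_of_lt
      ((Nat.modEq_and_modEq_iff_modEq_mul h).1 ⟨hkl.1, hkl.2⟩) hk hl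
  · rintro ⟨i, j⟩ hij
    simp only [Finset.mem_coe, Finset.mem_product, Finset.mem_filter, Finset.mem_range] at hij
    obtain ⟨⟨hi, hPi⟩, hj, hQj⟩ := hij
    have h1 := (Nat.chineseRemainder h i j).2.1
    have h2 := (Nat.chineseRemainder h i j).2.2
    have h3 := Nat.chineseRemainder_lt_mul h i j hm hn
    set k : ℕ := (Nat.chineseRemainder h i j).1
    have h1' : k % m = i := Eq.trans h1 (Nat.mod_eq_of_lt hi)
    have h2' : k % n = j := Eq.trans h2 (Nat.mod_eq_of_lt hj)
    refine ⟨k, ?_, by simp only [h1', h2']⟩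
    rw [Finset.mem_coe, Finset.mem_filter, Finset.mem_range]
    exact ⟨h3, (hP k).1 (h1'.symm ▸ hPi), (hQ k).1 (h2'.symm ▸ hQj)⟩

lemma card_filter_range_sq {p : ℕ} (hp : 0 < p) [DecidablePred fun n => p ∣ n → p ^ 2 ∣ n] :
    ((Finset.range (p ^ 2)).filter fun n => p ∣ n → p ^ 2 ∣ n).card + (p - 1) = p ^ 2 := by
  classical
  have himage : (Finset.range (p ^ 2)).filter (fun n => ¬ (p ∣ n → p ^ 2 ∣ n)) =
      (Finset.Ico 1 p).image (p * ·) := by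
    ext n
    simp only [Finset.mem_filter, Finset.mem_range, Finset.mem_image, Finset.mem_Ico,
      Classical.not_imp]
    constructor
    · rintro ⟨hn, ⟨j, rfl⟩, h⟩
      rw [sq, Nat.mul_lt_mul_left hp] at hn
      refine ⟨j, ⟨Nat.one_le_iff_ne_zero.2 ?_, hn⟩, rfl⟩
      rintro rfl
      exact h (dvd_zero _)
    · rintro ⟨j, ⟨h1, h2⟩, rfl⟩
      refine ⟨by rw [sq]; exact Nat.mul_lt_mul_of_pos_left h2 hp, dvd_mul_right _ _, ?_⟩
      rw [sq, Nat.mul_dvd_mul_iff_left hp]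
      exact Nat.not_dvd_of_pos_of_lt h1 h2
  rw [← Nat.card_Ico 1 p, ← Finset.card_image_of_injective (Finset.Ico 1 p)
    (mul_right_injective₀ hp.ne'), ← himage, Finset.card_filter_add_card_filter_not,
    Finset.card_range]

open scoped Classical in
/-- In a residue system modulo `p ^ 2` exactly `p - 1` numbers are divisible by `p` just once, and
different primes are independent. -/
lemma card_noSimpleFactor {T : Finset ℕ} (hT : ∀ p ∈ T, p.Prime) :
    (((Finset.range (∏ p ∈ T, p ^ 2)).filter (NoSimpleFactor T)).card : ℝ) =
      (∏ p ∈ T, p ^ 2 : ℕ) * ∏ p ∈ T, (1 - ((p : ℝ) - 1) / p ^ 2) := by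
  induction T using Finset.induction_on with
  | empty =>
    have h : ∀ n, NoSimpleFactor ∅ n := fun n p hp => absurd hp (Finset.notMem_empty p)
    simp [Finset.filter_true_of_mem fun n _ => h n]
  | insert p T hpT ih =>
    have hp := hT p (Finset.mem_insert_self p T)
    have hT' : ∀ r ∈ T, r.Prime := fun r hr => hT r (Finset.mem_insert_of_mem hr)
    have hM : (∏ r ∈ T, r ^ 2) ≠ 0 :=
      Finset.prod_ne_zero_iff.2 fun r hr => pow_ne_zero 2 (hT' r hr).ne_zero
    have hcop : (p ^ 2).Coprime (∏ r ∈ T, r ^ 2) := by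
      refine Nat.Coprime.prod_right fun r hr => Nat.Coprime.pow 2 2 ?_
      exact (Nat.coprime_primes hp (hT' r hr)).2 fun h => hpT (h ▸ hr)
    have hsplit : ∀ n, NoSimpleFactor (insert p T) n ↔ (p ∣ n → p ^ 2 ∣ n) ∧ NoSimpleFactor T n :=
      fun n => Finset.forall_mem_insert _ _ _
    have hp0 : (p : ℝ) ≠ 0 := Nat.cast_ne_zero.2 hp.ne_zero
    have hcard : (((Finset.range (p ^ 2)).filter fun n => p ∣ n → p ^ 2 ∣ n).card : ℝ) =
        p ^ 2 * (1 - ((p : ℝ) - 1) / p ^ 2) := by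
      have h : (((Finset.range (p ^ 2)).filter fun n => p ∣ n → p ^ 2 ∣ n).card : ℝ) +
          ((p - 1 : ℕ) : ℝ) = (p : ℝ) ^ 2 := by exact_mod_cast card_filter_range_sq hp.pos
      rw [Nat.cast_sub hp.one_le, Nat.cast_one] at h
      field_simp
      linarith
    simp only [hsplit]
    rw [Finset.prod_insert hpT, Finset.prod_insert hpT,
      card_filter_range_mul_of_coprime (pow_ne_zero 2 hp.ne_zero) hM hcop (fun k => ?_)
        (noSimpleFactor_mod_iff fun r hr => Finset.dvd_prod_of_mem (fun r => r ^ 2) hr),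
      Nat.cast_mul, ih hT', hcard]
    · push_cast
      ring
    · rw [Nat.dvd_mod_iff dvd_rfl, Nat.dvd_mod_iff (dvd_pow_self p two_ne_zero)]

lemma ncard_le_of_periodic {S : Set ℕ} {M c : ℕ} (hM : 0 < M) {P : ℕ → Prop} [DecidablePred P]
    (hP : ∀ k, P (k % M) ↔ P k) (hS : ∀ n ∈ S, P n)
    (hc : ((Finset.range M).filter P).card = c) {x : ℝ} (hx : 0 ≤ x) :
    ({n : ℕ | (n : ℝ) ≤ x ∧ n ∈ S}.ncard : ℝ) ≤ (x / M + 1) * c := by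
  classical
  have hsub : {n : ℕ | (n : ℝ) ≤ x ∧ n ∈ S} ⊆
      ((Finset.range (⌊x⌋₊ + 1)).filter P : Finset ℕ) := by
    rintro n ⟨hn, hnS⟩
    rw [Finset.mem_coe, Finset.mem_filter, Finset.mem_range]
    exact ⟨Nat.lt_succ_of_le (Nat.le_floor hn), hS n hnS⟩
  have h1 := Set.ncard_le_ncard hsub (Finset.finite_toSet _)
  rw [Set.ncard_coe_finset] at h1
  have h2 : ((Finset.range (⌊x⌋₊ + 1)).filter P).card ≤ (⌊x⌋₊ / M + 1) * c := by
    rw [← hc, ← Finset.card_range (⌊x⌋₊ / M + 1), ← Finset.card_product]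
    refine Finset.card_le_card_of_injOn (fun n => (n / M, n % M)) ?_ ?_
    · intro n hn
      rw [Finset.mem_coe, Finset.mem_filter, Finset.mem_range] at hn
      simp only [Finset.coe_product, Set.mem_prod, Finset.mem_coe, Finset.mem_filter,
        Finset.mem_range, hP]
      exact ⟨Nat.lt_succ_of_le (Nat.div_le_div_right (Nat.le_of_lt_succ hn.1)),
        Nat.mod_lt _ hM, hn.2⟩
    · intro a _ b _ hab
      rw [Prod.mk.injEq] at hab
      rw [← Nat.div_add_mod a M, ← Nat.div_add_mod b M, hab.1, hab.2]
  have h3 : ((⌊x⌋₊ / M : ℕ) : ℝ) ≤ x / M :=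
    Nat.cast_div_le.trans (div_le_div_of_nonneg_right (Nat.floor_le hx) (Nat.cast_nonneg M))
  calc _ ≤ (((⌊x⌋₊ / M + 1) * c : ℕ) : ℝ) := by exact_mod_cast h1.trans h2
    _ = ((⌊x⌋₊ / M : ℕ) + 1 : ℝ) * c := by push_cast; rfl
    _ ≤ _ := by gcongr

lemma countingRatio_nonneg (S : Set ℕ) {x : ℝ} (hx : 0 ≤ x) : 0 ≤ countingRatio S x :=
  div_nonneg (Nat.cast_nonneg _) hx

/-- A set contained in a periodic set has upper density at most the density of the latter. -/
lemma eventually_countingRatio_lt_of_periodic {S : Set ℕ} {M c : ℕ} (hM : 0 < M) {P : ℕ → Prop}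
    [DecidablePred P] (hP : ∀ k, P (k % M) ↔ P k) (hS : ∀ n ∈ S, P n)
    (hc : ((Finset.range M).filter P).card = c) {d : ℝ} (hd : (c : ℝ) / M < d) :
    ∀ᶠ x in Filter.atTop, countingRatio S x < d := by
  have hlim : Filter.Tendsto (fun x : ℝ => (c : ℝ) / M + c / x) Filter.atTop
      (nhds ((c : ℝ) / M + 0)) := tendsto_const_nhds.add (Filter.Tendsto.const_div_atTop
        Filter.tendsto_id _)
  rw [add_zero] at hlim
  filter_upwards [hlim.eventually_lt_const hd, Filter.eventually_gt_atTop 0] with x hx hx0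
  refine lt_of_le_of_lt ?_ hx
  rw [countingRatio, div_le_iff₀ hx0]
  refine (ncard_le_of_periodic hM hP hS hc hx0.le).trans_eq ?_
  field_simp

lemma prod_one_sub_le_exp {T : Finset ℕ} (hT : ∀ p ∈ T, p.Prime) :
    ∏ p ∈ T, (1 - ((p : ℝ) - 1) / p ^ 2) ≤ Real.exp (-(∑ p ∈ T, 1 / (p : ℝ)) / 2) := by
  rw [neg_div, Finset.sum_div, ← Finset.sum_neg_distrib, Real.exp_sum]
  refine Finset.prod_le_prod (fun p hp => ?_) (fun p hp => ?_)
  · have h2 : (2 : ℝ) ≤ p := mod_cast (hT p hp).two_le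
    rw [sub_nonneg, div_le_one (by positivity)]
    nlinarith
  · have h2 : (2 : ℝ) ≤ p := mod_cast (hT p hp).two_le
    refine le_trans ?_ (Real.add_one_le_exp _)
    have : 1 / (p : ℝ) / 2 ≤ ((p : ℝ) - 1) / p ^ 2 := by
      rw [div_div, div_le_div_iff₀ (by positivity) (by positivity)]
      nlinarith
    linarith

/-- If the reciprocals of the primes with property `p` have a divergent sum, almost every natural
number is divisible exactly once by such a prime. -/
theorem hasNaturalDensity_zero_of_noSimpleFactor {S : Set ℕ} {P : ℕ → Prop} [DecidablePred P]
    (hP : ∀ p, P p → p.Prime)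
    (hdiv : ¬ Summable fun n : ℕ => if P n then 1 / (n : ℝ) else 0)
    (hS : ∀ n ∈ S, ∀ p, P p → p ∣ n → p ^ 2 ∣ n) : HasNaturalDensity S 0 := by
  classical
  have hpartial := (not_summable_iff_tendsto_nat_atTop_of_nonneg
    (fun n => by positivity)).1 hdiv
  refine tendsto_order.2 ⟨fun d hd => ?_, fun d hd => ?_⟩
  · filter_upwards [Filter.eventually_ge_atTop 0] with x hx
    exact hd.trans_le (countingRatio_nonneg S hx)
  · have hexp : Filter.Tendsto (fun N : ℕ => Real.exp (-(∑ n ∈ Finset.range N,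
        if P n then 1 / (n : ℝ) else 0) / 2)) Filter.atTop (nhds 0) :=
      Real.tendsto_exp_atBot.comp
        ((Filter.tendsto_neg_atTop_atBot.comp hpartial).atBot_div_const two_pos)
    obtain ⟨N, hN⟩ := (hexp.eventually_lt_const hd).exists
    set T := (Finset.range N).filter P
    have hT : ∀ p ∈ T, p.Prime := fun p hp => hP p (Finset.mem_filter.1 hp).2
    have hM : 0 < ∏ p ∈ T, p ^ 2 := Finset.prod_pos fun p hp => pow_pos (hT p hp).pos 2
    refine eventually_countingRatio_lt_of_periodic (P := NoSimpleFactor T) hM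
      (noSimpleFactor_mod_iff fun p hp => Finset.dvd_prod_of_mem (fun p => p ^ 2) hp)
      (fun n hn p hp => hS n hn p (Finset.mem_filter.1 hp).2) rfl ?_
    rw [card_noSimpleFactor hT, mul_div_cancel_left₀ _ (Nat.cast_ne_zero.2 hM.ne')]
    rw [← Finset.sum_filter] at hN
    exact (prod_one_sub_le_exp hT).trans_lt hN

/-! ### Primes that no value of the two forms contains exactly once -/

/-- A prime `p` for which `a * X ^ 2 + b * Y ^ 2` is anisotropic modulo `p` divides both variables of
any value that it divides. -/
lemma sq_dvd_of_not_isSquare {p : ℕ} [Fact p.Prime] {a b : ℕ} (ha : (a : ZMod p) ≠ 0)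
    (hab : ¬ IsSquare (-(a * b) : ZMod p)) {u v : ℕ} (h : p ∣ a * u ^ 2 + b * v ^ 2) :
    p ^ 2 ∣ a * u ^ 2 + b * v ^ 2 := by
  have h0 : (a * u ^ 2 + b * v ^ 2 : ZMod p) = 0 := by
    exact_mod_cast (ZMod.natCast_eq_zero_iff _ p).2 h
  have hv : (v : ZMod p) = 0 := by
    by_contra hv
    refine hab ⟨a * u / v, ?_⟩
    field_simp
    linear_combination -h0
  have hu : (u : ZMod p) = 0 := by
    rw [hv] at h0
    simpa [ha] using h0
  rw [ZMod.natCast_eq_zero_iff] at hu hv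
  exact dvd_add ((pow_dvd_pow_of_dvd hu 2).mul_left a) ((pow_dvd_pow_of_dvd hv 2).mul_left b)

/-- Modulo a prime `p ≡ 23` modulo 24, neither `-1` nor `-6` is a square. -/
lemma sq_dvd_of_form {p : ℕ} (hp : p.Prime) (hmod : p % 24 = 23) {n : ℕ}
    (hn : (∃ u v, n = u ^ 2 + v ^ 2) ∨ ∃ u v, n = 3 * u ^ 2 + 2 * v ^ 2) (hpn : p ∣ n) :
    p ^ 2 ∣ n := by
  have := Fact.mk hp
  have h3 : ((3 : ℕ) : ZMod p) ≠ 0 := fun h => by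
    have := Nat.le_of_dvd three_pos ((ZMod.natCast_eq_zero_iff 3 p).1 h)
    omega
  rcases hn with ⟨u, v, rfl⟩ | ⟨u, v, rfl⟩
  · have h1 : ¬ IsSquare (-((1 : ℕ) * (1 : ℕ)) : ZMod p) := by
      rw [Nat.cast_one, mul_one, ZMod.exists_sq_eq_neg_one_iff]
      omega
    simpa using sq_dvd_of_not_isSquare (by simp) h1 (u := u) (v := v) (by simpa using hpn)
  · refine sq_dvd_of_not_isSquare h3 ?_ hpn
    have hthree : IsSquare ((3 : ℕ) : ZMod p) := by
      have htwo : ¬ IsSquare ((2 : ℕ) : ZMod 3) := by decide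
      have := Fact.mk Nat.prime_three
      rw [ZMod.exists_sq_eq_prime_iff_of_mod_four_eq_three (by omega) rfl (by omega),
        ← ZMod.natCast_mod, show p % 3 = 2 by omega]
      exact htwo
    have htwo : ¬ IsSquare (-2 : ZMod p) := by
      rw [ZMod.exists_sq_eq_neg_two_iff (by omega)]
      omega
    intro h
    refine htwo ?_
    have := h.div hthree
    rwa [← mul_neg, mul_div_cancel_left₀ _ h3, Nat.cast_ofNat] at this

/-! ### Densities -/

lemma hasNaturalDensity_zero_of_not_seven_mod_eight :
    HasNaturalDensity {n : ℕ | ¬ n ≡ 7 [MOD 8] ∧ Odd (oddMultPartitionCount n)} 0 := by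
  have hunit : IsUnit (23 : ZMod 24) := by decide
  refine hasNaturalDensity_zero_of_noSimpleFactor
    (P := fun p => p.Prime ∧ (p : ZMod 24) = 23) (fun p hp => hp.1)
    (not_summable_one_div_primes_eq_mod hunit) ?_
  rintro n ⟨h7, hn⟩ p ⟨hp, hmod⟩
  have hmod : p % 24 = 23 := (ZMod.natCast_eq_natCast_iff' p 23 24).1 hmod
  exact sq_dvd_of_form hp hmod (exists_form_of_odd_oddMultPartitionCount h7 hn)

lemma countingRatio_union_le (S T : Set ℕ) {x : ℝ} (hx : 0 ≤ x) :
    countingRatio (S ∪ T) x ≤ countingRatio S x + countingRatio T x := by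
  rw [countingRatio, countingRatio, countingRatio, ← add_div]
  refine div_le_div_of_nonneg_right ?_ hx
  have : {n : ℕ | (n : ℝ) ≤ x ∧ n ∈ S ∪ T} =
      {n : ℕ | (n : ℝ) ≤ x ∧ n ∈ S} ∪ {n : ℕ | (n : ℝ) ≤ x ∧ n ∈ T} := by
    ext n
    exact and_or_left
  rw [this]
  exact_mod_cast Set.ncard_union_le _ _

lemma eventually_countingRatio_lt {d : ℝ} (hd : 1 / 8 < d) :
    ∀ᶠ x in Filter.atTop, countingRatio {n : ℕ | Odd (oddMultPartitionCount n)} x < d := by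
  set S : Set ℕ := {n : ℕ | ¬ n ≡ 7 [MOD 8] ∧ Odd (oddMultPartitionCount n)}
  set T : Set ℕ := {n : ℕ | n ≡ 7 [MOD 8] ∧ Odd (oddMultPartitionCount n)}
  obtain ⟨e, he1, he2⟩ := exists_between hd
  have hT : ∀ᶠ x in Filter.atTop, countingRatio T x < e :=
    eventually_countingRatio_lt_of_periodic (M := 8) (c := 1) (P := fun n => n ≡ 7 [MOD 8])
      (by norm_num) (fun k => by rw [Nat.ModEq, Nat.mod_mod, Nat.ModEq]) (fun n hn => hn.1)
      (by decide) (by exact_mod_cast he1)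
  have hS := hasNaturalDensity_zero_of_not_seven_mod_eight.eventually_lt_const (sub_pos.2 he2)
  filter_upwards [hT, hS, Filter.eventually_ge_atTop 0] with x hTx hSx hx
  have hST : {n : ℕ | Odd (oddMultPartitionCount n)} = S ∪ T := by
    ext n
    have := em (n ≡ 7 [MOD 8])
    simp only [S, T, Set.mem_union, Set.mem_ofPred_eq]
    tauto
  rw [hST]
  linarith [countingRatio_union_le S T hx]

theorem mainTheorem4 :
    HasNaturalDensity {n : ℕ | ¬ n ≡ 7 [MOD 8] ∧ Odd (oddMultPartitionCount n)} 0 ∧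
    upperNaturalDensity {n : ℕ | Odd (oddMultPartitionCount n)} ≤ 1 / 8 ∧
    (∀ d : ℝ, HasNaturalDensity {n : ℕ | Odd (oddMultPartitionCount n)} d → d ≤ 1 / 8) := by
  refine ⟨hasNaturalDensity_zero_of_not_seven_mod_eight, ?_, fun d hd => ?_⟩
  · refine le_of_forall_gt_imp_ge_of_dense fun d hd => ?_
    -- The real `limsup` needs a lower bound on the ratio, which is nonnegative for `x ≥ 0`.
    refine Filter.limsup_le_of_le (Filter.isCoboundedUnder_le_of_eventually_le (x := 0) _ ?_)
      ((eventually_countingRatio_lt hd).mono fun _ => le_of_lt)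
    filter_upwards [Filter.eventually_ge_atTop 0] with x hx
    exact countingRatio_nonneg _ hx
  · refine le_of_forall_gt_imp_ge_of_dense fun e he => ?_
    exact le_of_tendsto hd ((eventually_countingRatio_lt he).mono fun _ => le_of_lt)
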